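/- Let $k$ be a field and let $n\ge 1$ be an integer. For a ring $R$, $\operatorname{Kdim} R$ denotes its right (Gabriel--Rentschler) Krull dimension, that is, the deviation of the poset of right ideals of $R$; noetherian means left and right noetherian. Let $\mathcal P$ be the class of polycyclic-by-finite groups, that is, of groups with a finite subnormal series all of whose factors are cyclic or finite. Suppose that every group $F$ such that the group algebra $kF$ is noetherian with $\operatorname{Kdim} kF<n$ belongs to $\mathcal P$, and suppose that $H\notin\mathcal P$ is a group such that $kH$ is noetherian with $\operatorname{Kdim} kH=n$. Then there exists a group $G$ such that 1. $G$ is just infinite, that is, $G$ is infinite and $G/N$ is finite for every normal subgroup $N\neq 1$ of $G$; 2. $G\notin\mathcal P$, and $kG$ is noetherian with $\operatorname{Kdim} kG=n$; 3. $G$ is (isomorphic to) a subfactor of $H$, that is, $G\cong L/N$ for some subgroup $L\le H$ and some normal subgroup $N$ of $L$; 4. $kG$ is a prime ring. -/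

import Mathlib

universe u v

/-- `DevLE α A` says that the partially ordered set `A` has deviation, and that its deviation is at
most `α`. Here `⊥ : WithBot Ordinal` is the value `-∞`, and only trivial posets have deviation
`-∞`. For an ordinal `α`, in every descending chain `a 0 ≥ a 1 ≥ ⋯` all but finitely many of the
factors `{x | a (i + 1) ≤ x ≤ a i}` have deviation less than `α`. -/
def DevLE (α : WithBot Ordinal.{v}) (A : Type v) [PartialOrder A] : Prop :=
  (∀ x y : A, x ≤ y → x = y) ∨
    (α ≠ ⊥ ∧ ∀ a : ℕ → A, Antitone a →
      ∃ N : ℕ, ∀ i ≥ N, ∃ β : WithBot Ordinal.{v}, ∃ _ : β < α,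
        DevLE β (Set.Icc (a (i + 1)) (a i)))
termination_by wellFounded_lt.wrap α

/-- The deviation of a partially ordered set, `⊤` if it does not exist. -/
noncomputable def deviation (A : Type v) [PartialOrder A] : WithTop (WithBot Ordinal.{v}) :=
  ⨅ (α : WithBot Ordinal.{v}) (_ : DevLE α A), (α : WithTop (WithBot Ordinal.{v}))

/-- The right (Gabriel-Rentschler) Krull dimension of a ring: the deviation of its poset of right
ideals, `⊤` if it does not exist. -/
noncomputable def rightKdim (R : Type v) [Ring R] : WithTop (WithBot Ordinal.{v}) :=
  deviation (Submodule Rᵐᵒᵖ R)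

/-- A (left and right) noetherian ring. -/
def IsTwoSidedNoetherian (R : Type v) [Ring R] : Prop :=
  IsNoetherian R R ∧ IsNoetherian Rᵐᵒᵖ R

/-- A prime (not necessarily commutative) ring. -/
def IsPrimeRing (R : Type v) [Ring R] : Prop :=
  Nontrivial R ∧ ∀ a b : R, (∀ r : R, a * r * b = 0) → a = 0 ∨ b = 0

/-- Polycyclic-by-finite groups: there is a finite subnormal series all of whose factors are cyclic
or finite. -/
def IsPolycyclicByFinite (G : Type v) [Group G] : Prop :=
  ∃ (m : ℕ) (S : ℕ → Subgroup G), S 0 = ⊥ ∧ S m = ⊤ ∧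
    ∀ i < m, S i ≤ S (i + 1) ∧
      ∃ _ : ((S i).subgroupOf (S (i + 1))).Normal,
        IsCyclic (S (i + 1) ⧸ (S i).subgroupOf (S (i + 1))) ∨
          Finite (S (i + 1) ⧸ (S i).subgroupOf (S (i + 1)))

/-- A just infinite group: infinite, with all proper factor groups finite. -/
def IsJustInfinite (G : Type v) [Group G] : Prop :=
  Infinite G ∧ ∀ N : Subgroup G, N.Normal → N ≠ ⊥ → Finite (G ⧸ N)

/-- `G` is (isomorphic to) a subfactor `L / N` of `H`, where `N ⊲ L ≤ H`. -/
def IsSubfactor (G : Type v) [Group G] (H : Type v) [Group H] : Prop :=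
  ∃ (L : Subgroup H) (N : Subgroup L) (_ : N.Normal), Nonempty (G ≃* L ⧸ N)

/-! Krull dimension bounds how often one can pass to smaller bad subgroups of `H`, where "bad" means
not polycyclic-by-finite. Given a bad `N ≤ H`, the noetherian condition yields a factor `N/K` that
is bad while all its proper factors are not. If `N/K` is not just infinite, it has an infinite
polycyclic-by-finite factor, hence an infinite cyclic section: a bad `M < N` and an `x ∈ N`
normalizing `M` with infinite order modulo `M`. Right multiplication by `x`, minus the identity, is
an injective endomorphism of the permutation module `k[H/M]`, and its cokernel maps onto `k[H/N]`,
so `Kdim k[H/N] < Kdim k[H/M]`. Since `k[H/M]` is a cyclic `kH`-module, its dimension is at most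
`n`, so iteration must reach a just infinite bad subfactor `G`.

Lattice embeddings make `kG` noetherian of dimension at most `n`, and minimality of `n` gives
equality. A nontrivial finite conjugacy class would make `G` abelian-by-finite and finitely
generated, hence not bad; so all nontrivial classes are infinite, which forces `kG` to be prime. -/

theorem DevLE.of_strictMono {α : WithBot Ordinal.{v}} {A B : Type v} [PartialOrder A]
    [PartialOrder B] {f : A → B} (hf : StrictMono f) (h : DevLE α B) : DevLE α A := by
  induction α using WellFoundedLT.induction generalizing A B with
  | ind α ih =>
  rw [DevLE] at h ⊢
  rcases h with h | ⟨hα, h⟩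
  · left
    intro x y hxy
    by_contra hne
    exact (hf (lt_of_le_of_ne hxy hne)).ne (h _ _ (hf.monotone hxy))
  · right
    refine ⟨hα, fun a ha => ?_⟩
    obtain ⟨N, hN⟩ := h (f ∘ a) (hf.monotone.comp_antitone ha)
    refine ⟨N, fun i hi => ?_⟩
    obtain ⟨β, hβ, hdev⟩ := hN i hi
    refine ⟨β, hβ, ih β hβ (f := fun x => ⟨f x.1, hf.monotone x.2.1, hf.monotone x.2.2⟩)
      (fun x y hxy => ?_) hdev⟩
    exact hf hxy

theorem deviation_le_of_strictMono {A B : Type v} [PartialOrder A] [PartialOrder B] {f : A → B}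
    (hf : StrictMono f) : deviation A ≤ deviation B :=
  le_iInf₂ fun α hα => iInf₂_le α (hα.of_strictMono hf)

theorem deviation_eq_of_orderIso {A B : Type v} [PartialOrder A] [PartialOrder B] (e : A ≃o B) :
    deviation A = deviation B :=
  le_antisymm (deviation_le_of_strictMono e.strictMono)
    (deviation_le_of_strictMono e.symm.strictMono)

theorem le_deviation {A : Type v} [PartialOrder A] {γ : WithBot Ordinal.{v}}
    (h : ∀ α, DevLE α A → γ ≤ α) : (γ : WithTop (WithBot Ordinal.{v})) ≤ deviation A :=
  le_iInf₂ fun α hα => WithTop.coe_le_coe.2 (h α hα)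

theorem not_devLE_bot (A : Type v) [PartialOrder A] {x y : A} (h : x < y) : ¬ DevLE ⊥ A := by
  rw [DevLE]
  rintro (h' | h')
  · exact h.ne (h' _ _ h.le)
  · exact h'.1 rfl

/-- If `V` has an injective endomorphism `f` whose cokernel maps onto a nonzero module `W`, then the
Krull dimension of `W` is strictly smaller than that of `V`. -/
theorem DevLE.exists_lt_of_injective_endomorphism {R : Type u} [Ring R] {V W : Type v}
    [AddCommGroup V] [Module R V] [AddCommGroup W] [Module R W] [Nontrivial W]
    (f : V →ₗ[R] V) (hf : Function.Injective f) (φ : V →ₗ[R] W) (hφ : Function.Surjective φ)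
    (hφf : ∀ x, φ (f x) = 0) {α : WithBot Ordinal.{v}} (h : DevLE α (Submodule R V)) :
    ∃ β < α, DevLE β (Submodule R W) := by
  rw [DevLE] at h
  rcases h with h | ⟨-, h⟩
  · exfalso
    have : (⊥ : Submodule R V) = ⊤ := h _ _ bot_le
    obtain ⟨w, hw⟩ := exists_ne (0 : W)
    obtain ⟨x, rfl⟩ := hφ w
    have hx : x ∈ (⊥ : Submodule R V) := this ▸ Submodule.mem_top
    rw [Submodule.mem_bot] at hx
    exact hw (by rw [hx, map_zero])
  · have hinj : ∀ i : ℕ, Function.Injective (f ^ i) := fun i => by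
      rw [Module.End.coe_pow]; exact hf.iterate i
    -- In the chain of images `f^i V`, the map `U ↦ f^N (φ⁻¹ U)` embeds the submodules of `W` into
    -- the factor between `f^(N+1) V` and `f^N V`.
    obtain ⟨N, hN⟩ := h (fun i => LinearMap.range (f ^ i))
      (antitone_nat_of_succ_le fun i => by
        rintro _ ⟨y, rfl⟩
        exact ⟨f y, by rw [pow_succ, Module.End.mul_apply]⟩)
    obtain ⟨β, hβ, hdev⟩ := hN N le_rfl
    have hle : ∀ U : Submodule R W, LinearMap.range (f ^ (N + 1)) ≤ (U.comap φ).map (f ^ N) := by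
      rintro U _ ⟨y, rfl⟩
      refine ⟨f y, ?_, by rw [pow_succ, Module.End.mul_apply]⟩
      change φ (f y) ∈ U
      rw [hφf]; exact U.zero_mem
    have hge : ∀ U : Submodule R W, (U.comap φ).map (f ^ N) ≤ LinearMap.range (f ^ N) := by
      rintro U _ ⟨y, -, rfl⟩
      exact ⟨y, rfl⟩
    refine ⟨β, hβ, DevLE.of_strictMono
      (f := fun U : Submodule R W => ⟨(U.comap φ).map (f ^ N), hle U, hge U⟩) ?_ hdev⟩
    intro U U' hU
    exact Submodule.map_strictMono_of_injective (hinj N)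
      (Submodule.comap_strictMono_of_surjective hφ hU)

/-! ### Steps of a subnormal series -/

section Steps

variable {G : Type*} [Group G] {G' : Type*} [Group G']

/-- `A` has finite index in `B`, expressed by a finite set of coset representatives. -/
def IsFiniteStep (A B : Subgroup G) : Prop :=
  ∃ F : Set G, F.Finite ∧ F ⊆ B ∧ ∀ y ∈ B, ∃ x ∈ F, x⁻¹ * y ∈ A

/-- `B` is generated by `x` modulo `A`. -/
def IsCyclicStep (A B : Subgroup G) (x : G) : Prop :=
  x ∈ B ∧ ∀ y ∈ B, ∃ z : ℤ, (x ^ z)⁻¹ * y ∈ A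

/-- `A` is normal in `B` and the factor group is cyclic or finite. -/
structure IsStep (A B : Subgroup G) : Prop where
  le : A ≤ B
  conj : ∀ b ∈ B, ∀ a ∈ A, b * a * b⁻¹ ∈ A
  factor : (∃ x, IsCyclicStep A B x) ∨ IsFiniteStep A B

/-- Describing the factor by elements of `G` rather than by a quotient type makes it easy to
transport along homomorphisms. -/
theorem isStep_iff (A B : Subgroup G) :
    (A ≤ B ∧ ∃ _ : (A.subgroupOf B).Normal,
      IsCyclic (B ⧸ A.subgroupOf B) ∨ Finite (B ⧸ A.subgroupOf B)) ↔ IsStep A B := by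
  constructor
  · rintro ⟨hle, hn, h⟩
    refine ⟨hle, fun b hb a ha => ?_, ?_⟩
    · exact hn.conj_mem ⟨a, hle ha⟩ (by simpa [Subgroup.mem_subgroupOf] using ha) ⟨b, hb⟩
    · rcases h with h | h
      · left
        obtain ⟨q, hq⟩ := h.exists_generator
        obtain ⟨x, rfl⟩ := QuotientGroup.mk_surjective q
        refine ⟨x, x.2, fun y hy => ?_⟩
        obtain ⟨z, hz⟩ := hq (QuotientGroup.mk ⟨y, hy⟩)
        refine ⟨z, ?_⟩
        have hz' : ((x ^ z : B) : B ⧸ A.subgroupOf B) = QuotientGroup.mk ⟨y, hy⟩ := hz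
        rw [QuotientGroup.eq, Subgroup.mem_subgroupOf] at hz'
        simpa using hz'
      · right
        refine ⟨Set.range fun q : B ⧸ A.subgroupOf B => (q.out : G), Set.finite_range _, ?_, ?_⟩
        · rintro _ ⟨q, rfl⟩
          exact q.out.2
        · intro y hy
          refine ⟨_, ⟨QuotientGroup.mk ⟨y, hy⟩, rfl⟩, ?_⟩
          have := (QuotientGroup.eq (s := A.subgroupOf B)).1
            (Quotient.out_eq' (QuotientGroup.mk (s := A.subgroupOf B) ⟨y, hy⟩))
          simpa [Subgroup.mem_subgroupOf] using this
  · intro h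
    have hn : (A.subgroupOf B).Normal := ⟨fun a ha b => by
      rw [Subgroup.mem_subgroupOf] at ha ⊢
      exact h.conj b b.2 a ha⟩
    refine ⟨h.le, hn, ?_⟩
    rcases h.factor with ⟨x, hx, hxy⟩ | ⟨F, hF, hFB, hcov⟩
    · left
      refine ⟨⟨QuotientGroup.mk ⟨x, hx⟩, fun q => ?_⟩⟩
      obtain ⟨y, rfl⟩ := QuotientGroup.mk_surjective q
      obtain ⟨z, hz⟩ := hxy y y.2
      refine ⟨z, ?_⟩
      change ((⟨x, hx⟩ ^ z : B) : B ⧸ A.subgroupOf B) = QuotientGroup.mk y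
      rw [QuotientGroup.eq, Subgroup.mem_subgroupOf]
      simpa using hz
    · right
      have := hF.to_subtype
      refine Finite.of_surjective
        (fun x : F => (QuotientGroup.mk ⟨x.1, hFB x.2⟩ : B ⧸ A.subgroupOf B)) fun q => ?_
      obtain ⟨y, rfl⟩ := QuotientGroup.mk_surjective q
      obtain ⟨x, hx, hxy⟩ := hcov y y.2
      refine ⟨⟨x, hx⟩, ?_⟩
      rw [QuotientGroup.eq, Subgroup.mem_subgroupOf]
      simpa using hxy

theorem IsStep.map {A B : Subgroup G} (h : IsStep A B) (φ : G →* G') :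
    IsStep (A.map φ) (B.map φ) := by
  refine ⟨Subgroup.map_mono h.le, ?_, ?_⟩
  · rintro _ ⟨b, hb, rfl⟩ _ ⟨a, ha, rfl⟩
    exact ⟨_, h.conj b hb a ha, by simp⟩
  · rcases h.factor with ⟨x, hx, hxy⟩ | ⟨F, hF, hFB, hcov⟩
    · refine Or.inl ⟨φ x, ⟨x, hx, rfl⟩, ?_⟩
      rintro _ ⟨y, hy, rfl⟩
      obtain ⟨z, hz⟩ := hxy y hy
      exact ⟨z, _, hz, by simp⟩
    · refine Or.inr ⟨φ '' F, hF.image _, ?_, ?_⟩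
      · rintro _ ⟨x, hx, rfl⟩
        exact ⟨x, hFB hx, rfl⟩
      · rintro _ ⟨y, hy, rfl⟩
        obtain ⟨x, hx, hxy⟩ := hcov y hy
        exact ⟨φ x, ⟨x, hx, rfl⟩, _, hxy, by simp⟩

theorem IsStep.comap {A B : Subgroup G'} (h : IsStep A B) (φ : G →* G')
    (hφ : Function.Surjective φ) : IsStep (A.comap φ) (B.comap φ) := by
  refine ⟨Subgroup.comap_mono h.le, fun b hb a ha => ?_, ?_⟩
  · simpa using h.conj _ hb _ ha
  · rcases h.factor with ⟨x, hx, hxy⟩ | ⟨F, hF, hFB, hcov⟩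
    · obtain ⟨x, rfl⟩ := hφ x
      refine Or.inl ⟨x, hx, fun y hy => ?_⟩
      obtain ⟨z, hz⟩ := hxy _ hy
      exact ⟨z, by simpa using hz⟩
    · refine Or.inr ⟨Function.surjInv hφ '' F, hF.image _, ?_, fun y hy => ?_⟩
      · rintro _ ⟨x, hx, rfl⟩
        change φ _ ∈ B
        rw [Function.surjInv_eq hφ]
        exact hFB hx
      · obtain ⟨x, hx, hxy⟩ := hcov _ hy
        exact ⟨_, ⟨x, hx, rfl⟩, by simpa [Function.surjInv_eq hφ] using hxy⟩

theorem IsFiniteStep.finite {A B : Subgroup G} (h : IsFiniteStep A B) (hA : (A : Set G).Finite) :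
    (B : Set G).Finite := by
  obtain ⟨F, hF, -, hcov⟩ := h
  refine (hF.mul hA).subset fun y hy => ?_
  obtain ⟨x, hx, hxy⟩ := hcov y hy
  exact ⟨x, hx, _, hxy, by simp⟩

/-- Used contrapositively: in a cyclic step that is not finite, the generator has infinite order
modulo `A`. -/
theorem IsCyclicStep.isFiniteStep {A B : Subgroup G} {x : G} (h : IsCyclicStep A B x) {z : ℤ}
    (hz : z ≠ 0) (hxz : x ^ z ∈ A) : IsFiniteStep A B := by
  refine ⟨(fun r : ℤ => x ^ r) '' Set.Ico 0 |z|, (Set.finite_Ico _ _).image _, ?_, fun y hy => ?_⟩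
  · rintro _ ⟨r, -, rfl⟩
    exact B.zpow_mem h.1 r
  · obtain ⟨t, ht⟩ := h.2 y hy
    refine ⟨x ^ (t % z), ⟨t % z, ⟨Int.emod_nonneg t hz, Int.emod_lt_abs t hz⟩, rfl⟩, ?_⟩
    have : (x ^ (t % z))⁻¹ * y = (x ^ z) ^ (t / z) * ((x ^ t)⁻¹ * y) := by
      rw [← mul_assoc, ← zpow_mul, ← zpow_neg, ← zpow_neg, ← zpow_add]
      congr 2
      have := Int.emod_add_mul_ediv t z
      lia
    rw [this]
    exact A.mul_mem (A.zpow_mem hxz _) ht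

end Steps

/-! ### Polycyclic-by-finite groups -/

section Polycyclic

variable {G : Type*} [Group G]

theorem isPolycyclicByFinite_iff : IsPolycyclicByFinite G ↔
    ∃ (m : ℕ) (S : ℕ → Subgroup G), S 0 = ⊥ ∧ S m = ⊤ ∧ ∀ i < m, IsStep (S i) (S (i + 1)) := by
  simp only [IsPolycyclicByFinite, isStep_iff]

theorem IsPolycyclicByFinite.of_surjective {G' : Type*} [Group G'] (h : IsPolycyclicByFinite G)
    (φ : G →* G') (hφ : Function.Surjective φ) : IsPolycyclicByFinite G' := by
  rw [isPolycyclicByFinite_iff] at h ⊢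
  obtain ⟨m, S, h0, hm, hS⟩ := h
  refine ⟨m, fun i => (S i).map φ, by simp [h0], ?_, fun i hi => (hS i hi).map φ⟩
  simp [hm, ← MonoidHom.range_eq_map, MonoidHom.range_eq_top.2 hφ]

theorem IsPolycyclicByFinite.of_isStep {A B : Subgroup G} (h : IsPolycyclicByFinite A)
    (hAB : IsStep A B) : IsPolycyclicByFinite B := by
  rw [isPolycyclicByFinite_iff] at h ⊢
  obtain ⟨m, S, h0, hm, hS⟩ := h
  refine ⟨m + 1, fun i => if i ≤ m then (S i).map (Subgroup.inclusion hAB.le) else ⊤, by simp [h0],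
    by simp, fun i hi => ?_⟩
  rcases Nat.lt_or_ge i m with him | him
  · simpa [him.le, Nat.succ_le_of_lt him] using (hS i him).map _
  · obtain rfl : i = m := by lia
    have hA : ∀ b : B, b ∈ (S i).map (Subgroup.inclusion hAB.le) ↔ (b : G) ∈ A := by
      intro b
      rw [hm]
      constructor
      · rintro ⟨a, -, rfl⟩
        exact a.2
      · intro hb
        exact ⟨⟨b, hb⟩, trivial, rfl⟩
    simp only [le_refl, if_true, Nat.not_succ_le_self, if_false]
    refine ⟨le_top, fun b _ a ha => ?_, ?_⟩
    · rw [hA] at ha ⊢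
      exact hAB.conj b b.2 a ha
    · rcases hAB.factor with ⟨x, hx, hxy⟩ | ⟨F, hF, hFB, hcov⟩
      · refine Or.inl ⟨⟨x, hx⟩, trivial, fun y _ => ?_⟩
        obtain ⟨z, hz⟩ := hxy y y.2
        exact ⟨z, by simpa [hA] using hz⟩
      · refine Or.inr ⟨Subtype.val ⁻¹' F, hF.preimage Subtype.val_injective.injOn,
          fun _ _ => trivial, fun y _ => ?_⟩
        obtain ⟨x, hx, hxy⟩ := hcov y y.2
        exact ⟨⟨x, hFB hx⟩, hx, by simpa [hA] using hxy⟩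

theorem isPolycyclicByFinite_bot : IsPolycyclicByFinite (⊥ : Subgroup G) :=
  isPolycyclicByFinite_iff.2 ⟨0, fun _ => ⊥, rfl, Subsingleton.elim _ _, by simp⟩

theorem IsPolycyclicByFinite.of_top (h : IsPolycyclicByFinite (⊤ : Subgroup G)) :
    IsPolycyclicByFinite G :=
  h.of_surjective (Subgroup.subtype _) fun g => ⟨⟨g, trivial⟩, rfl⟩

theorem isFiniteStep_top_of_finiteIndex (A : Subgroup G) [A.FiniteIndex] : IsFiniteStep A ⊤ := by
  refine ⟨Set.range fun q : G ⧸ A => q.out, Set.finite_range _, fun _ _ => trivial, fun y _ => ?_⟩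
  refine ⟨_, ⟨QuotientGroup.mk y, rfl⟩, ?_⟩
  exact QuotientGroup.eq.1 (Quotient.out_eq' (QuotientGroup.mk (s := A) y))

theorem IsPolycyclicByFinite.of_normal_finiteIndex {A : Subgroup G} [hA : A.Normal]
    [A.FiniteIndex] (h : IsPolycyclicByFinite A) : IsPolycyclicByFinite G :=
  (h.of_isStep (B := ⊤) ⟨le_top, fun b _ a ha => hA.conj_mem a ha b,
    Or.inr (isFiniteStep_top_of_finiteIndex A)⟩).of_top

theorem isPolycyclicByFinite_of_finite [Finite G] : IsPolycyclicByFinite G :=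
  isPolycyclicByFinite_bot.of_normal_finiteIndex

theorem isPolycyclicByFinite_of_fg_of_comm [hG : Group.FG G] (hcomm : ∀ x y : G, x * y = y * x) :
    IsPolycyclicByFinite G := by
  classical
  have key : ∀ s : Finset G, IsPolycyclicByFinite (Subgroup.closure (s : Set G)) := by
    intro s
    induction s using Finset.induction with
    | empty =>
      rw [Finset.coe_empty, Subgroup.closure_empty]
      exact isPolycyclicByFinite_bot
    | insert a s _ ih =>
      -- Adjoining one generator to a subgroup of a commutative group is a cyclic step.
      refine ih.of_isStep ⟨Subgroup.closure_mono (by simp), fun b _ c hc => ?_, Or.inl ⟨a, ?_, ?_⟩⟩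
      · rwa [hcomm b, mul_assoc, mul_inv_cancel, mul_one]
      · exact Subgroup.subset_closure (by simp)
      · intro y hy
        rw [Finset.coe_insert] at hy
        induction hy using Subgroup.closure_induction with
        | mem y hy =>
          rcases hy with rfl | hy
          · exact ⟨1, by simp⟩
          · exact ⟨0, by simpa using Subgroup.subset_closure hy⟩
        | one => exact ⟨0, by simp⟩
        | mul y y' _ _ h h' =>
          obtain ⟨z, hz⟩ := h
          obtain ⟨z', hz'⟩ := h'
          refine ⟨z + z', ?_⟩
          have : (a ^ (z + z'))⁻¹ * (y * y') = ((a ^ z)⁻¹ * y) * ((a ^ z')⁻¹ * y') := by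
            rw [zpow_add, mul_inv_rev, hcomm (a ^ z')⁻¹, mul_assoc, mul_assoc, ← mul_assoc _ y,
              hcomm _ y, mul_assoc]
          rw [this]
          exact mul_mem hz hz'
        | inv y _ h =>
          obtain ⟨z, hz⟩ := h
          refine ⟨-z, ?_⟩
          have : (a ^ (-z))⁻¹ * y⁻¹ = ((a ^ z)⁻¹ * y)⁻¹ := by
            rw [zpow_neg, inv_inv, mul_inv_rev, inv_inv, hcomm]
          rw [this]
          exact inv_mem hz
  obtain ⟨-, s, -, hs⟩ := Group.fg_iff'.1 hG
  have h := key s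
  rw [hs] at h
  exact h.of_top

/-- If `G` is not polycyclic-by-finite but has an infinite polycyclic-by-finite factor group, then
some subgroup `M` of `G` that is not polycyclic-by-finite is normalized by an element of infinite
order modulo `M`. -/
theorem exists_normalizing_of_infinite_quotient (hG : ¬ IsPolycyclicByFinite G) (A : Subgroup G)
    [A.Normal] [hinf : Infinite (G ⧸ A)] (hA : IsPolycyclicByFinite (G ⧸ A)) :
    ∃ (M : Subgroup G) (x : G), ¬ IsPolycyclicByFinite M ∧ (∀ a ∈ M, x * a * x⁻¹ ∈ M) ∧
      (∀ a ∈ M, x⁻¹ * a * x ∈ M) ∧ ∀ z : ℤ, z ≠ 0 → x ^ z ∉ M := by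
  obtain ⟨m, S, h0, hm, hS⟩ := isPolycyclicByFinite_iff.1 hA
  obtain ⟨i, him, hi⟩ : ∃ i < m, ¬ IsFiniteStep (S i) (S (i + 1)) := by
    by_contra! hcon
    have hfin : ∀ i ≤ m, (S i : Set (G ⧸ A)).Finite := by
      intro i
      induction i with
      | zero => intro; simp [h0]
      | succ i ih => exact fun hi => (hcon i hi).finite (ih (by lia))
    have := hfin m le_rfl
    rw [hm, Subgroup.coe_top, Set.finite_univ_iff] at this
    exact not_finite (G ⧸ A)
  have hsurj := QuotientGroup.mk'_surjective A
  obtain ⟨x, hx⟩ := (hS i him).factor.resolve_right hi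
  obtain ⟨x, rfl⟩ := hsurj x
  refine ⟨(S i).comap (QuotientGroup.mk' A), x, fun hP => hG ?_, fun a ha => ?_, fun a ha => ?_,
    fun z hz hxz => hi (hx.isFiniteStep hz (by simpa using hxz))⟩
  -- If the preimage of `S i` were polycyclic-by-finite, climbing the remaining steps would make `G`
  -- so.
  · have hP' : ∀ j, i ≤ j → j ≤ m →
        IsPolycyclicByFinite ((S j).comap (QuotientGroup.mk' A)) := by
      intro j hij
      induction j, hij using Nat.le_induction with
      | base => exact fun _ => hP
      | succ j _ ih => exact fun hj => (ih (by lia)).of_isStep ((hS j hj).comap _ hsurj)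
    have h := hP' m him.le le_rfl
    rw [hm, Subgroup.comap_top] at h
    exact h.of_top
  · simpa using (hS i him).conj _ hx.1 _ ha
  · simpa using (hS i him).conj _ (inv_mem hx.1) _ ha

end Polycyclic

/-! ### Ideal lattices of group algebras -/

namespace MonoidAlgebra

variable {k : Type v} [Field k] {G : Type u} [Group G]

/-- The anti-automorphism of a group algebra that inverts the group elements. -/
noncomputable def invOpEquiv (k : Type v) [Field k] (G : Type u) [Group G] :
    MonoidAlgebra k G ≃+* (MonoidAlgebra k G)ᵐᵒᵖ :=
  ((mapDomainRingEquiv k (MulEquiv.inv' G)).trans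
    (mapRingEquiv (Gᵐᵒᵖ) (RingEquiv.toOpposite k))).trans MonoidAlgebra.opRingEquiv.symm

/-- The lattices of right and left ideals of a group algebra are isomorphic. -/
noncomputable def rightIdealOrderIso (k : Type v) [Field k] (G : Type u) [Group G] :
    Submodule (MonoidAlgebra k G)ᵐᵒᵖ (MonoidAlgebra k G) ≃o Ideal (MonoidAlgebra k G) :=
  letI e := invOpEquiv k G
  Submodule.orderIsoMapComapOfBijective
    (σ₁₂ := (e.symm : (MonoidAlgebra k G)ᵐᵒᵖ →+* MonoidAlgebra k G))
    { toFun := fun r => e.symm (MulOpposite.op r)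
      map_add' := fun x y => by rw [MulOpposite.op_add, map_add]
      map_smul' := fun r x => by
        rw [MulOpposite.smul_eq_mul_unop, MulOpposite.op_mul, map_mul]
        rfl }
    (e.symm.bijective.comp MulOpposite.op_bijective)

/-- Inversion of group elements swaps the two sides, so only left ideals need be considered from
here on. -/
theorem rightKdim_eq (k : Type v) [Field k] (G : Type u) [Group G] :
    rightKdim (MonoidAlgebra k G) = deviation (Ideal (MonoidAlgebra k G)) :=
  deviation_eq_of_orderIso (rightIdealOrderIso k G)

theorem isTwoSidedNoetherian_iff (k : Type v) [Field k] (G : Type u) [Group G] :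
    IsTwoSidedNoetherian (MonoidAlgebra k G) ↔ WellFoundedGT (Ideal (MonoidAlgebra k G)) := by
  rw [IsTwoSidedNoetherian, isNoetherian_iff', isNoetherian_iff']
  refine ⟨fun h => h.1, fun h => ⟨h, ?_⟩⟩
  exact (rightIdealOrderIso k G).strictMono.wellFoundedGT

variable (k) in
theorem strictMono_map_of_subgroup (L : Subgroup G) :
    StrictMono (Ideal.map (mapDomainRingHom k L.subtype)) := by
  -- Restriction of coefficients to `L` is a right `kL`-linear retraction of `kG` onto `kL`; hence
  -- an extended left ideal meets `kL` in the original one.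
  have hmul : ∀ (r : MonoidAlgebra k G) (a : MonoidAlgebra k L),
      comapDomain L.subtype L.subtype_injective (r * mapDomainRingHom k L.subtype a) =
        comapDomain L.subtype L.subtype_injective r * a := by
    intro r a
    induction a using induction_linear with
    | zero => simp
    | add a a' h h' => rw [map_add, mul_add, comapDomain_add, h, h', mul_add]
    | single l c =>
      ext m
      simp
  have hmem : ∀ (I : Ideal (MonoidAlgebra k L)) (x : MonoidAlgebra k L),
      mapDomainRingHom k L.subtype x ∈ I.map (mapDomainRingHom k L.subtype) → x ∈ I := by
    intro I x hx
    have key : ∀ y ∈ I.map (mapDomainRingHom k L.subtype), ∀ r,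
        comapDomain L.subtype L.subtype_injective (r * y) ∈ I := by
      intro y hy
      induction hy using Submodule.span_induction with
      | mem y hy =>
        obtain ⟨a, ha, rfl⟩ := hy
        intro r
        rw [hmul]
        exact I.mul_mem_left _ ha
      | zero => simp
      | add y y' _ _ h h' =>
        intro r
        rw [mul_add, comapDomain_add]
        exact I.add_mem (h r) (h' r)
      | smul s y _ h =>
        intro r
        rw [smul_eq_mul, ← mul_assoc]
        exact h _
    have h1 := key _ hx 1
    rw [hmul] at h1
    have h2 : comapDomain L.subtype L.subtype_injective (1 : MonoidAlgebra k G) = 1 := by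
      have := comapDomain_single_map L.subtype L.subtype_injective 1 (1 : k)
      rwa [map_one] at this
    rwa [h2, one_mul] at h1
  refine Monotone.strictMono_of_injective (fun _ _ => Ideal.map_mono) fun I J hIJ => ?_
  ext x
  constructor
  · exact fun hx => hmem J x (hIJ ▸ Ideal.mem_map_of_mem _ hx)
  · exact fun hx => hmem I x (hIJ.symm ▸ Ideal.mem_map_of_mem _ hx)

theorem mapDomainRingHom_surjective {G' : Type*} [Group G'] (φ : G →* G')
    (hφ : Function.Surjective φ) : Function.Surjective (mapDomainRingHom k φ) := by
  intro y
  obtain ⟨x, hx⟩ := Finsupp.mapDomain_surjective hφ y.coeff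
  refine ⟨ofCoeff x, ?_⟩
  ext1
  exact hx

/-- The lattice of left ideals of the group algebra of a subfactor of `G` embeds into that of
`G`. -/
theorem exists_strictMono_of_subfactor (k : Type v) [Field k] (L : Subgroup G) (N : Subgroup L)
    [N.Normal] :
    ∃ f : Ideal (MonoidAlgebra k (L ⧸ N)) → Ideal (MonoidAlgebra k G), StrictMono f :=
  ⟨_, (strictMono_map_of_subgroup k L).comp (Ideal.orderEmbeddingOfSurjective
    (mapDomainRingHom k (QuotientGroup.mk' N))
    (mapDomainRingHom_surjective _ (QuotientGroup.mk'_surjective N))).strictMono⟩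

/-- A group with noetherian group algebra has the maximal condition on normal subgroups. -/
theorem wellFoundedGT_normal_subgroups (k : Type v) [Field k] (G : Type u) [Group G]
    [WellFoundedGT (Ideal (MonoidAlgebra k G))] : WellFoundedGT {N : Subgroup G // N.Normal} := by
  let f : {N : Subgroup G // N.Normal} → Ideal (MonoidAlgebra k G) := fun N =>
    Ideal.span ((fun g => single g 1 - 1) '' (N : Set G))
  have hf : Monotone f := fun N M hNM => Ideal.span_mono (Set.image_mono hNM)
  refine (hf.strictMono_of_injective fun N M hNM => ?_).wellFoundedGT
  -- `N` is recovered from its ideal, since that ideal dies in `k[G/N]`.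
  have key : ∀ (N : {N : Subgroup G // N.Normal}) (g : G), single g 1 - 1 ∈ f N → g ∈ N.1 := by
    intro N g hg
    have := N.2
    have hle : f N ≤ RingHom.ker (mapDomainRingHom k (QuotientGroup.mk' N.1)) := by
      refine Ideal.span_le.2 ?_
      rintro _ ⟨x, hx, rfl⟩
      have hx' : (x : G ⧸ N.1) = 1 := (QuotientGroup.eq_one_iff x).2 hx
      rw [SetLike.mem_coe, RingHom.mem_ker, map_sub, map_one, mapDomainRingHom_apply,
        mapDomain_single]
      exact sub_eq_zero.2 (congrArg (single · 1) hx')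
    have h := hle hg
    rw [RingHom.mem_ker, map_sub, map_one, sub_eq_zero, mapDomainRingHom_apply, mapDomain_single,
      one_def, single_left_inj one_ne_zero] at h
    exact (QuotientGroup.eq_one_iff g).1 h
  ext g
  exact ⟨fun hg => key M g (hNM ▸ Ideal.subset_span ⟨g, hg, rfl⟩),
    fun hg => key N g (hNM.symm ▸ Ideal.subset_span ⟨g, hg, rfl⟩)⟩

end MonoidAlgebra

/-! ### Permutation modules -/

/-- The permutation module of `G` over `k` on the cosets of a subgroup. -/
abbrev PermModule (k : Type v) [Field k] {G : Type u} [Group G] (M : Subgroup G) : Type (max u v) :=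
  (Representation.ofMulAction k G (G ⧸ M)).asModule

namespace PermModule

variable {k : Type v} [Field k] {G : Type u} [Group G]

/-- The coordinates of an element of a permutation module. -/
def coeff {M : Subgroup G} (v : PermModule k M) : G ⧸ M →₀ k :=
  MonoidAlgebra.coeff v

theorem ext {M : Subgroup G} {v w : PermModule k M} (h : v.coeff = w.coeff) : v = w :=
  MonoidAlgebra.coeff_injective h

/-- The element of a permutation module with given coordinates. -/
def ofCoeff {M : Subgroup G} (p : G ⧸ M →₀ k) : PermModule k M :=
  MonoidAlgebra.ofCoeff p

theorem coeff_ofCoeff {M : Subgroup G} (p : G ⧸ M →₀ k) : (ofCoeff p).coeff = p := rfl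

theorem coeff_zero {M : Subgroup G} : (0 : PermModule k M).coeff = 0 := rfl

theorem coeff_add {M : Subgroup G} (v w : PermModule k M) :
    (v + w).coeff = v.coeff + w.coeff := rfl

theorem coeff_single_smul {M : Subgroup G} (g : G) (c : k) (v : PermModule k M) :
    (MonoidAlgebra.single g c • v).coeff = c • Finsupp.mapDomain (g • ·) v.coeff := by
  rw [Representation.single_smul]
  rfl

/-- A `G`-equivariant map of coset spaces induces a homomorphism of permutation modules. -/
noncomputable def map (k : Type v) [Field k] {G : Type u} [Group G] {M N : Subgroup G}
    (τ : G ⧸ M → G ⧸ N) (hτ : ∀ (g : G) p, τ (g • p) = g • τ p) :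
    PermModule k M →ₗ[MonoidAlgebra k G] PermModule k N where
  toFun v := ofCoeff (Finsupp.mapDomain τ v.coeff)
  map_add' x y := ext (Finsupp.mapDomain_add (f := τ) (v₁ := x.coeff) (v₂ := y.coeff))
  map_smul' r v := by
    rw [RingHom.id_apply]
    apply ext
    rw [coeff_ofCoeff]
    induction r using MonoidAlgebra.induction_linear with
    | zero => rw [zero_smul, zero_smul, coeff_zero, coeff_zero, Finsupp.mapDomain_zero]
    | add r s hr hs =>
      rw [add_smul, add_smul, coeff_add, coeff_add, Finsupp.mapDomain_add, hr, hs]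
    | single g c =>
      rw [coeff_single_smul, coeff_single_smul, coeff_ofCoeff, Finsupp.mapDomain_smul,
        ← Finsupp.mapDomain_comp, ← Finsupp.mapDomain_comp]
      congr 2
      exact funext (hτ g)

theorem coeff_map {M N : Subgroup G} (τ : G ⧸ M → G ⧸ N)
    (hτ : ∀ (g : G) p, τ (g • p) = g • τ p) (v : PermModule k M) :
    (map k τ hτ v).coeff = Finsupp.mapDomain τ v.coeff := rfl

instance (M : Subgroup G) : Nontrivial (PermModule k M) :=
  inferInstanceAs (Nontrivial (MonoidAlgebra k (G ⧸ M)))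

/-- A fixed vector has constant coefficients along the infinite forward orbits of `τ`, so finite
support forces it to vanish. -/
theorem map_sub_id_injective {M : Subgroup G} (τ : G ⧸ M → G ⧸ M)
    (hτ : ∀ (g : G) p, τ (g • p) = g • τ p) (hinj : Function.Injective τ)
    (hfree : ∀ p, Function.Injective fun i : ℕ => τ^[i] p) :
    Function.Injective (map k τ hτ - LinearMap.id : Module.End (MonoidAlgebra k G) _) := by
  rw [injective_iff_map_eq_zero]
  intro v hv
  rw [LinearMap.sub_apply, LinearMap.id_apply, sub_eq_zero] at hv
  have hv' : Finsupp.mapDomain τ v.coeff = v.coeff := by rw [← coeff_map τ hτ, hv]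
  have hstep : ∀ p, v.coeff (τ p) = v.coeff p := fun p => by
    conv_lhs => rw [← hv']
    exact Finsupp.mapDomain_apply hinj _ _
  refine ext (Finsupp.ext fun p => ?_)
  by_contra hp
  have hsupp : ∀ i : ℕ, τ^[i] p ∈ v.coeff.support := by
    intro i
    induction i with
    | zero => exact Finsupp.mem_support_iff.2 hp
    | succ i ih =>
      rw [Function.iterate_succ_apply', Finsupp.mem_support_iff, hstep]
      exact Finsupp.mem_support_iff.1 ih
  exact Set.infinite_of_injective_forall_mem (hfree p) hsupp v.coeff.support.finite_toSet

theorem map_surjective {M N : Subgroup G} (τ : G ⧸ M → G ⧸ N)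
    (hτ : ∀ (g : G) p, τ (g • p) = g • τ p) (h : Function.Surjective τ) :
    Function.Surjective (map k τ hτ) := fun w => by
  obtain ⟨x, hx⟩ := Finsupp.mapDomain_surjective h w.coeff
  exact ⟨ofCoeff x, ext hx⟩

/-- If `x ∈ N` normalizes a subgroup `M` of `N` and has infinite order modulo `M`, then the Krull
dimension of the permutation module on the cosets of `N` is smaller than that for `M`. -/
theorem exists_devLE_lt {M N : Subgroup G} (hMN : M ≤ N) {x : G} (hxN : x ∈ N)
    (hx : ∀ a ∈ M, x * a * x⁻¹ ∈ M) (hx' : ∀ a ∈ M, x⁻¹ * a * x ∈ M)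
    (hxz : ∀ z : ℤ, z ≠ 0 → x ^ z ∉ M) {α : WithBot Ordinal}
    (h : DevLE α (Submodule (MonoidAlgebra k G) (PermModule k M))) :
    ∃ β < α, DevLE β (Submodule (MonoidAlgebra k G) (PermModule k N)) := by
  -- Right multiplication by `x`: `hx'` makes it well defined, and `hx` will make it injective.
  let τ : G ⧸ M → G ⧸ M := Quotient.map' (· * x) fun a b hab => by
    rw [QuotientGroup.leftRel_apply] at hab ⊢
    simpa [mul_assoc] using hx' _ hab
  have hτmk : ∀ g : G, τ g = (g * x : G) := fun g => rfl
  have hτ : ∀ (g : G) p, τ (g • p) = g • τ p := by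
    rintro g ⟨p⟩
    change τ ((g * p : G) : G ⧸ M) = g • τ (p : G ⧸ M)
    rw [hτmk, hτmk, mul_assoc]
    rfl
  let π : G ⧸ M → G ⧸ N := Subgroup.quotientMapOfLE hMN
  have hπ : ∀ (g : G) p, π (g • p) = g • π p := by
    rintro g ⟨p⟩
    rfl
  have hπτ : π ∘ τ = π := by
    refine funext fun p => p.inductionOn' fun p => ?_
    change ((p * x : G) : G ⧸ N) = (p : G ⧸ N)
    rw [QuotientGroup.eq]
    simpa using hxN
  refine h.exists_lt_of_injective_endomorphism (map k τ hτ - LinearMap.id)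
    (map_sub_id_injective τ hτ ?_ ?_) (map k π hπ) (map_surjective π hπ ?_) ?_
  · rintro ⟨p⟩ ⟨q⟩ hpq
    change ((p * x : G) : G ⧸ M) = (q * x : G) at hpq
    rw [QuotientGroup.eq] at hpq
    change (p : G ⧸ M) = (q : G ⧸ M)
    rw [QuotientGroup.eq]
    simpa [mul_assoc] using hx _ hpq
  · rintro ⟨p⟩ i j hij
    have hiter : ∀ i : ℕ, τ^[i] (p : G ⧸ M) = (p * x ^ i : G) := by
      intro i
      induction i with
      | zero => simp
      | succ i ih => rw [Function.iterate_succ_apply', ih, hτmk, pow_succ, mul_assoc]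
    change τ^[i] (p : G ⧸ M) = τ^[j] (p : G ⧸ M) at hij
    rw [hiter, hiter, QuotientGroup.eq] at hij
    by_contra hne
    refine hxz (-i + j) (by lia) ?_
    rw [zpow_add, zpow_neg, zpow_natCast, zpow_natCast]
    simpa [mul_assoc] using hij
  · rintro ⟨p⟩
    exact ⟨(p : G ⧸ M), rfl⟩
  · intro v
    rw [LinearMap.sub_apply, LinearMap.id_apply, map_sub, sub_eq_zero]
    refine ext ?_
    rw [coeff_map, coeff_map, coeff_map, ← Finsupp.mapDomain_comp, hπτ]

/-- Every permutation module on cosets is cyclic, so its Krull dimension is at most that of the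
group algebra. -/
theorem exists_strictMono (k : Type v) [Field k] {G : Type u} [Group G] (M : Subgroup G) :
    ∃ f : Submodule (MonoidAlgebra k G) (PermModule k M) → Ideal (MonoidAlgebra k G),
      StrictMono f := by
  let v : PermModule k M := MonoidAlgebra.single ((1 : G) : G ⧸ M) 1
  have hsurj : Function.Surjective (LinearMap.toSpanSingleton (MonoidAlgebra k G) _ v) := by
    rw [← LinearMap.range_eq_top, eq_top_iff]
    intro w _
    refine MonoidAlgebra.induction_linear (motive := fun w : MonoidAlgebra k (G ⧸ M) =>
      (show PermModule k M from w) ∈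
        LinearMap.range (LinearMap.toSpanSingleton (MonoidAlgebra k G) _ v)) w ?_ ?_ ?_
    · exact Submodule.zero_mem _
    · exact fun a b ha hb => Submodule.add_mem _ ha hb
    · rintro ⟨g⟩ c
      refine ⟨MonoidAlgebra.single g c, ?_⟩
      rw [LinearMap.toSpanSingleton_apply, Representation.single_smul]
      change c • Representation.ofMulAction k G (G ⧸ M) g
        (MonoidAlgebra.single ((1 : G) : G ⧸ M) 1) = _
      rw [Representation.ofMulAction_single, MonoidAlgebra.smul_single, smul_eq_mul, mul_one]
      change MonoidAlgebra.single ((g * 1 : G) : G ⧸ M) c = MonoidAlgebra.single (g : G ⧸ M) c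
      rw [mul_one]
  exact ⟨_, Submodule.comap_strictMono_of_surjective hsurj⟩

end PermModule

/-! ### Infinite conjugacy classes and primeness -/

theorem IsJustInfinite.not_finiteIndex_centralizer {G : Type u} [Group G] (hG : IsJustInfinite G)
    (hP : ¬ IsPolycyclicByFinite G) {y : G} (hy : y ≠ 1) :
    ¬ (Subgroup.centralizer {y}).FiniteIndex := by
  intro hfin
  let N := Subgroup.normalClosure {y}
  have hNbot : N ≠ ⊥ := fun h => hy (by
    have : y ∈ N := Subgroup.subset_normalClosure rfl
    rwa [h, Subgroup.mem_bot] at this)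
  have hNfin : N.FiniteIndex := by
    have := hG.2 N Subgroup.normalClosure_normal hNbot
    exact Subgroup.finiteIndex_of_finite_quotient
  have hconj : (Group.conjugatesOfSet {y}).Finite := by
    refine (Set.finite_range fun q : G ⧸ Subgroup.centralizer {y} =>
      q.out * y * q.out⁻¹).subset fun z hz => ?_
    obtain ⟨w, rfl, hwz⟩ := Group.mem_conjugatesOfSet_iff.1 hz
    obtain ⟨g, rfl⟩ := isConj_iff.1 hwz
    refine ⟨QuotientGroup.mk g, ?_⟩
    have h := QuotientGroup.eq.1 (Quotient.out_eq' (QuotientGroup.mk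
      (s := Subgroup.centralizer {w}) g))
    rw [Subgroup.mem_centralizer_singleton_iff] at h
    set o := Quotient.out (QuotientGroup.mk (s := Subgroup.centralizer {w}) g)
    calc o * w * o⁻¹ = o * (w * (o⁻¹ * g)) * g⁻¹ := by group
      _ = g * w * g⁻¹ := by rw [← h]; group
  have hNfg : Group.FG N := by
    rw [Group.fg_iff_subgroup_fg, Subgroup.fg_iff]
    exact ⟨_, rfl, hconj⟩
  -- The centre of `N` has finite index in `G`; being also of finite index in the finitely generated
  -- `N`, it is a finitely generated abelian group.
  let Z := N ⊓ Subgroup.centralizer (N : Set G)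
  have hCfin : (Subgroup.centralizer (N : Set G)).FiniteIndex := by
    change (Subgroup.centralizer (Subgroup.closure (Group.conjugatesOfSet {y}) : Set G)).FiniteIndex
    rw [Subgroup.centralizer_closure]
    have hle : (Subgroup.centralizer {y}).normalCore ≤
        Subgroup.centralizer (Group.conjugatesOfSet {y}) := by
      intro c hc
      rw [Subgroup.mem_centralizer_iff]
      intro z hz
      obtain ⟨w, rfl, hwz⟩ := Group.mem_conjugatesOfSet_iff.1 hz
      obtain ⟨g, rfl⟩ := isConj_iff.1 hwz
      have h := hc g⁻¹
      rw [Subgroup.mem_centralizer_singleton_iff] at h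
      calc g * w * g⁻¹ * c = g * (w * (g⁻¹ * c * g⁻¹⁻¹)) * g⁻¹ := by group
        _ = c * (g * w * g⁻¹) := by rw [← h]; group
    exact Subgroup.finiteIndex_of_le hle
  have hZn : Z.Normal := inferInstance
  have hZfin : Z.FiniteIndex := inferInstance
  have hZfg : Group.FG Z :=
    Group.fg_of_surjective (f := (Subgroup.subgroupOfEquivOfLe (inf_le_left : Z ≤ N)).toMonoidHom)
      (Subgroup.subgroupOfEquivOfLe _).surjective
  refine hP (IsPolycyclicByFinite.of_normal_finiteIndex (A := Z)
    (isPolycyclicByFinite_of_fg_of_comm fun a b => Subtype.ext ?_))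
  exact Subgroup.mem_centralizer_iff.1 b.2.2 a a.2.1

open scoped Pointwise in
/-- The group algebra of a group all of whose nontrivial conjugacy classes are infinite is prime. -/
theorem MonoidAlgebra.isPrimeRing_of_infinite_conj (k : Type v) [Field k] {G : Type u} [Group G]
    (hG : ∀ y : G, y ≠ 1 → ¬ (Subgroup.centralizer {y}).FiniteIndex) :
    IsPrimeRing (MonoidAlgebra k G) := by
  classical
  have key : ∀ a b : MonoidAlgebra k G, (∀ r, a * r * b = 0) → a.coeff 1 * b.coeff 1 = 0 := by
    intro a b hab
    by_contra hne
    -- The coefficient of `g` in `a * g * b = 0` is the sum of `a(x) b(g⁻¹x⁻¹g)`; its term at `x =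
    -- 1` is nonzero, so another one must be.
    have hex : ∀ g : G, ∃ x, a.coeff x ≠ 0 ∧ x ≠ 1 ∧ b.coeff (g⁻¹ * x⁻¹ * g) ≠ 0 := by
      intro g
      by_contra! hcon
      refine hne ?_
      have h : (a * (single g 1 * b)).coeff g = 0 := by rw [← mul_assoc, hab]; rfl
      rw [coeff_mul_apply_left, Finsupp.sum, Finset.sum_eq_single 1] at h
      · simpa using h
      · intro x hx hx1
        simpa [mul_assoc] using Or.inr (hcon x (Finsupp.mem_support_iff.1 hx) hx1)
      · intro h1
        rw [Finsupp.notMem_support_iff.1 h1, zero_mul]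
    let s : Finset (G × G) := ((a.coeff.support.erase 1) ×ˢ (b.coeff.support.erase 1)).filter
      fun p => ∃ g, g * p.2 * g⁻¹ = p.1⁻¹
    have hs : ∀ p : G × G, ∃ g, p ∈ s → g * p.2 * g⁻¹ = p.1⁻¹ := fun p => by
      by_cases hp : p ∈ s
      · exact (Finset.mem_filter.1 hp).2.imp fun _ h _ => h
      · exact ⟨1, fun h => absurd h hp⟩
    choose t ht using hs
    -- Finitely many cosets of centralizers cover `G`, so by B. H. Neumann's lemma one of these
    -- centralizers has finite index.
    have hcov : ⋃ p ∈ s, t p • (Subgroup.centralizer {p.2} : Set G) = Set.univ := by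
      refine Set.eq_univ_of_forall fun g => ?_
      obtain ⟨x, hx, hx1, hxb⟩ := hex g
      have hp : (x, g⁻¹ * x⁻¹ * g) ∈ s := by
        refine Finset.mem_filter.2 ⟨Finset.mem_product.2 ⟨?_, ?_⟩, g, by group⟩
        · exact Finset.mem_erase.2 ⟨hx1, Finsupp.mem_support_iff.2 hx⟩
        · refine Finset.mem_erase.2 ⟨fun h => hx1 ?_, Finsupp.mem_support_iff.2 hxb⟩
          dsimp only at h
          have h' : g * (g⁻¹ * x⁻¹ * g) * g⁻¹ = 1 := by rw [h]; group
          simpa [mul_assoc] using h'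
      refine Set.mem_iUnion₂.2 ⟨_, hp, ?_⟩
      rw [Set.mem_smul_set_iff_inv_smul_mem, SetLike.mem_coe,
        Subgroup.mem_centralizer_singleton_iff]
      have h := ht _ hp
      set u := t (x, g⁻¹ * x⁻¹ * g)
      dsimp only at h ⊢
      have hx' : x⁻¹ = g * (g⁻¹ * x⁻¹ * g) * g⁻¹ := by group
      rw [hx'] at h
      set y := g⁻¹ * x⁻¹ * g
      rw [smul_eq_mul]
      calc u⁻¹ * g * y = u⁻¹ * (g * y * g⁻¹) * g := by group
        _ = y * (u⁻¹ * g) := by rw [← h]; group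
    obtain ⟨p, hp, hfin⟩ := Subgroup.exists_finiteIndex_of_leftCoset_cover hcov
    exact hG p.2 (Finset.mem_erase.1 (Finset.mem_product.1 (Finset.mem_filter.1 hp).1).2).1 hfin
  refine ⟨inferInstance, fun a b hab => ?_⟩
  by_contra! hne
  obtain ⟨g, hg⟩ : ∃ g, a.coeff g ≠ 0 := by
    by_contra! h
    exact hne.1 (MonoidAlgebra.ext (Finsupp.ext h))
  obtain ⟨h, hh⟩ : ∃ g, b.coeff g ≠ 0 := by
    by_contra! h
    exact hne.2 (MonoidAlgebra.ext (Finsupp.ext h))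
  -- Translation moves nonzero coefficients of `a` and `b` to the identity.
  have := key (a * single g⁻¹ 1) (b * single h⁻¹ 1) fun r => by
    have := hab (single g⁻¹ 1 * r)
    calc a * single g⁻¹ 1 * r * (b * single h⁻¹ 1) = a * (single g⁻¹ 1 * r) * b * single h⁻¹ 1 := by
          simp only [mul_assoc]
      _ = 0 := by rw [this, zero_mul]
  simp [hg, hh] at this

/-! ### Descent through subgroups and conclusion -/

/-- A group that is not polycyclic-by-finite and has the maximal condition on normal subgroups has a
factor group that is not polycyclic-by-finite while all its proper factor groups are. -/
theorem exists_quotient_minimal_not_isPolycyclicByFinite {G : Type u} [Group G]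
    [hwf : WellFoundedGT {N : Subgroup G // N.Normal}] (hG : ¬ IsPolycyclicByFinite G) :
    ∃ (K : Subgroup G) (_ : K.Normal), ¬ IsPolycyclicByFinite (G ⧸ K) ∧
      ∀ A : Subgroup (G ⧸ K), ∀ _ : A.Normal, A ≠ ⊥ → IsPolycyclicByFinite ((G ⧸ K) ⧸ A) := by
  let P : Set {N : Subgroup G // N.Normal} := {N | haveI := N.2; ¬ IsPolycyclicByFinite (G ⧸ N.1)}
  have hbot : (⟨⊥, inferInstance⟩ : {N : Subgroup G // N.Normal}) ∈ P := fun h =>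
    hG (h.of_surjective (QuotientGroup.quotientBot (G := G)).toMonoidHom
      (QuotientGroup.quotientBot (G := G)).surjective)
  -- Minimal for `>`, so `K` is a maximal normal subgroup with bad factor group.
  obtain ⟨⟨K, hK⟩, hKP, hmax⟩ := hwf.wf.has_min P ⟨_, hbot⟩
  refine ⟨K, hK, hKP, fun A hA hAbot => ?_⟩
  let B : Subgroup G := A.comap (QuotientGroup.mk' K)
  have hB : B.Normal := hA.comap _
  have hKB : K < B := by
    refine lt_of_le_of_ne (fun g hg => ?_) fun h => hAbot ?_
    · have : (g : G ⧸ K) = 1 := (QuotientGroup.eq_one_iff g).2 hg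
      change (g : G ⧸ K) ∈ A
      rw [this]
      exact one_mem A
    · rw [eq_bot_iff]
      intro q hq
      obtain ⟨g, rfl⟩ := QuotientGroup.mk_surjective q
      have hg : g ∈ B := hq
      rw [← h] at hg
      exact (QuotientGroup.eq_one_iff g).2 hg
  have hBP : IsPolycyclicByFinite (G ⧸ B) := by
    by_contra h
    exact hmax ⟨B, hB⟩ h hKB
  refine hBP.of_surjective (QuotientGroup.map B A (QuotientGroup.mk' K) le_rfl) ?_
  exact QuotientGroup.map_surjective_of_surjective B A _
    ((QuotientGroup.mk'_surjective A).comp (QuotientGroup.mk'_surjective K)) le_rfl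

/-- Either some subgroup of `H` has a just infinite factor group that is not polycyclic-by-finite,
or there are subgroups of `H` that are not polycyclic-by-finite whose permutation modules have
arbitrarily large Krull dimension. -/
theorem exists_justInfinite_or_large_permModule (k : Type v) [Field k] {H : Type u} [Group H]
    (hH : ¬ IsPolycyclicByFinite H) [hwf : WellFoundedGT (Ideal (MonoidAlgebra k H))] (j : ℕ) :
    (∃ (N : Subgroup H) (K : Subgroup N) (_ : K.Normal),
      IsJustInfinite (N ⧸ K) ∧ ¬ IsPolycyclicByFinite (N ⧸ K)) ∨
    ∃ N : Subgroup H, ¬ IsPolycyclicByFinite N ∧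
      ∀ α, DevLE α (Submodule (MonoidAlgebra k H) (PermModule k N)) →
        (((j : Ordinal) : WithBot Ordinal)) ≤ α := by
  rw [or_iff_not_imp_left]
  intro hno
  push Not at hno
  induction j with
  | zero =>
    -- A nonzero module does not have deviation `-∞`, so its dimension is at least `0`.
    refine ⟨⊤, fun h => hH h.of_top, fun α hα => ?_⟩
    induction α with
    | bot => exact absurd hα (not_devLE_bot _ bot_lt_top)
    | coe α => exact WithBot.coe_le_coe.2 (by simp)
  | succ j ih =>
    obtain ⟨N, hN, hdev⟩ := ih
    have : WellFoundedGT (Ideal (MonoidAlgebra k N)) :=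
      (MonoidAlgebra.strictMono_map_of_subgroup k N).wellFoundedGT
    have := MonoidAlgebra.wellFoundedGT_normal_subgroups k N
    obtain ⟨K, hK, hKP, hmin⟩ := exists_quotient_minimal_not_isPolycyclicByFinite hN
    have hinf : Infinite (N ⧸ K) := by
      by_contra h
      rw [not_infinite_iff_finite] at h
      exact hKP isPolycyclicByFinite_of_finite
    have hnot : ¬ IsJustInfinite (N ⧸ K) := fun h => hKP (hno N K hK h)
    obtain ⟨A, hA, hAbot, hAinf⟩ : ∃ A : Subgroup (N ⧸ K), A.Normal ∧ A ≠ ⊥ ∧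
        Infinite ((N ⧸ K) ⧸ A) := by
      by_contra! hcon
      exact hnot ⟨hinf, fun A hA hAbot => by simpa using hcon A hA hAbot⟩
    obtain ⟨M, x, hM, hx, hx', hxz⟩ :=
      exists_normalizing_of_infinite_quotient hKP A (hmin A hA hAbot)
    obtain ⟨x, rfl⟩ := QuotientGroup.mk_surjective x
    let M' : Subgroup N := M.comap (QuotientGroup.mk' K)
    have hmem : ∀ g : H, g ∈ M'.map N.subtype ↔ ∃ hg : g ∈ N, ((⟨g, hg⟩ : N) : N ⧸ K) ∈ M := by
      intro g
      constructor
      · rintro ⟨y, hy, rfl⟩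
        exact ⟨y.2, hy⟩
      · rintro ⟨hg, h⟩
        exact ⟨⟨g, hg⟩, h, rfl⟩
    refine ⟨M'.map N.subtype, fun h => hM ?_, fun α hα => ?_⟩
    · have h' : IsPolycyclicByFinite M' := h.of_surjective
        (M'.equivMapOfInjective N.subtype N.subtype_injective).symm.toMonoidHom
        (M'.equivMapOfInjective N.subtype N.subtype_injective).symm.surjective
      refine h'.of_surjective ((QuotientGroup.mk' K).subgroupComap M) ?_
      exact MonoidHom.subgroupComap_surjective_of_surjective _ M
        (QuotientGroup.mk'_surjective K)
    · obtain ⟨β, hβ, hdevβ⟩ := PermModule.exists_devLE_lt (M := M'.map N.subtype) (N := N)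
        (Subgroup.map_subtype_le _) (x := (x : H)) x.2
        (fun a ha => by
          obtain ⟨haN, ha⟩ := (hmem a).1 ha
          exact (hmem _).2 ⟨(x * ⟨a, haN⟩ * x⁻¹ : N).2, hx _ ha⟩)
        (fun a ha => by
          obtain ⟨haN, ha⟩ := (hmem a).1 ha
          exact (hmem _).2 ⟨(x⁻¹ * ⟨a, haN⟩ * x : N).2, hx' _ ha⟩)
        (fun z hz h => hxz z hz ((hmem _).1 h).2) hα
      have hlt := (hdev β hdevβ).trans_lt hβ
      induction α with
      | bot => exact absurd hlt not_lt_bot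
      | coe α =>
        rw [WithBot.coe_lt_coe] at hlt
        rw [WithBot.coe_le_coe, Nat.cast_succ, Order.add_one_le_iff]
        exact hlt

theorem mainTheorem7 (k : Type v) [Field k] (n : ℕ) (hn : 0 < n)
    (hmin : ∀ (F : Type u) [Group F], IsTwoSidedNoetherian (MonoidAlgebra k F) →
      rightKdim (MonoidAlgebra k F) < (((n : Ordinal) : WithBot Ordinal) : WithTop (WithBot Ordinal)) →
      IsPolycyclicByFinite F)
    (H : Type u) [Group H] (hH : ¬ IsPolycyclicByFinite H)
    (hnoeth : IsTwoSidedNoetherian (MonoidAlgebra k H))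
    (hdim : rightKdim (MonoidAlgebra k H) =
      (((n : Ordinal) : WithBot Ordinal) : WithTop (WithBot Ordinal))) :
    ∃ (G : Type u) (_ : Group G),
      IsJustInfinite G ∧
      ¬ IsPolycyclicByFinite G ∧
      IsTwoSidedNoetherian (MonoidAlgebra k G) ∧
      rightKdim (MonoidAlgebra k G) =
        (((n : Ordinal) : WithBot Ordinal) : WithTop (WithBot Ordinal)) ∧
      IsSubfactor G H ∧
      IsPrimeRing (MonoidAlgebra k G) := by
  have hwf := (MonoidAlgebra.isTwoSidedNoetherian_iff k H).1 hnoeth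
  -- The bound `n + 1` exceeds the dimension of `kH`, which rules out the second alternative.
  rcases exists_justInfinite_or_large_permModule k hH (n + 1) with
    ⟨L, N, hN, hji, hP⟩ | ⟨N, -, hdev⟩
  · obtain ⟨f, hf⟩ := MonoidAlgebra.exists_strictMono_of_subfactor k L N
    have hno : IsTwoSidedNoetherian (MonoidAlgebra k (L ⧸ N)) :=
      (MonoidAlgebra.isTwoSidedNoetherian_iff k _).2 hf.wellFoundedGT
    have hle : rightKdim (MonoidAlgebra k (L ⧸ N)) ≤ rightKdim (MonoidAlgebra k H) := by
      rw [MonoidAlgebra.rightKdim_eq, MonoidAlgebra.rightKdim_eq]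
      exact deviation_le_of_strictMono hf
    rw [hdim] at hle
    refine ⟨L ⧸ N, inferInstance, hji, hP, hno, ?_, ⟨L, N, hN, ⟨MulEquiv.refl _⟩⟩,
      MonoidAlgebra.isPrimeRing_of_infinite_conj k fun y hy =>
        hji.not_finiteIndex_centralizer hP hy⟩
    exact hle.eq_of_not_lt fun hlt => hP (hmin _ hno hlt)
  · exfalso
    obtain ⟨f, hf⟩ := PermModule.exists_strictMono k N
    have h := (le_deviation hdev).trans (deviation_le_of_strictMono hf)
    rw [← MonoidAlgebra.rightKdim_eq, hdim, WithTop.coe_le_coe, WithBot.coe_le_coe, Nat.cast_le] at h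
    lia
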